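/- Let $\eta$ be the probability measure $\mathbf 1_{x\ge 0}\,e^{-x}\,dx$ on $\mathbb R$, let $n\ge 0$, and let $\eta^n$ be its $n$-fold product on $\mathbb R^n$. Write $\Lambda_\eta(t)=\log\int e^{tx}\,d\eta(x)\in(-\infty,+\infty]$ for $t\in\mathbb R$ and $\Lambda_{\eta^n}(\xi)=\log\int e^{\langle\xi,x\rangle}\,d\eta^n(x)\in(-\infty,+\infty]$ for $\xi\in\mathbb R^n$, where $\langle\cdot,\cdot\rangle$ is the standard inner product; for $\xi\in\mathbb R^n$ put $\Lambda_\eta(\xi)=(\Lambda_\eta(\xi_1),\ldots,\Lambda_\eta(\xi_n))$, and let $u=(1,\ldots,1)$. Then for every countable set $V\subset\mathbb R^n$, $$\log\int e^{\sup_{\xi\in V}\{\langle\xi,x\rangle-\Lambda_{\eta^n}(\xi)\}}\,d\eta^n(x)\;\le\;\int\sup_{\xi\in V}\langle\Lambda_\eta(\xi),x-u\rangle\,d\eta^n(x).$$ Both sides are understood in $[-\infty,+\infty]$, with $\log 0=-\infty$, $e^{-\infty}=0$, $\sup\emptyset=-\infty$, and, inside the inner product on the right, $0\cdot\infty=0$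 and $(+\infty)+(-\infty)=-\infty$. The integral of an extended-real-valued function $f$ is $\int f^+-\int f^-$, with the convention that it is $+\infty$ if $\int f^+=\int f^-=+\infty$. Moreover, if $\Lambda_{\eta^n}(\xi)<+\infty$ for all $\xi\in V$, then the integral on the right-hand side is well defined in $[-\infty,+\infty]$, that is, the positive and negative parts of the integrand do not both have infinite integral. -/

import Mathlib

open MeasureTheory

noncomputable section

/-- The exponential probability measure `1_{x ≥ 0} e^{-x} dx` on `ℝ`. -/
def expo : Measure ℝ := ProbabilityTheory.expMeasure 1

/-- The `n`-fold product of the exponential probability measure, on `ℝ^n`. -/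
def expoPi (n : ℕ) : Measure (Fin n → ℝ) := Measure.pi fun _ => expo

/-- The logarithmic Laplace transform `t ↦ log ∫ e^{t x} dμ(x)` of a measure on `ℝ`,
with values in `[-∞, +∞]`. -/
def logLaplaceReal (μ : Measure ℝ) (t : ℝ) : EReal :=
  ENNReal.log (∫⁻ x, ENNReal.ofReal (Real.exp (t * x)) ∂μ)

/-- The logarithmic Laplace transform `ξ ↦ log ∫ e^{⟨ξ, x⟩} dμ(x)` of a measure on `ℝ^n`,
with values in `[-∞, +∞]`. -/
def logLaplace {n : ℕ} (μ : Measure (Fin n → ℝ)) (ξ : Fin n → ℝ) : EReal :=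
  ENNReal.log (∫⁻ x, ENNReal.ofReal (Real.exp (ξ ⬝ᵥ x)) ∂μ)

/-- The integral of the positive part of an extended real valued function. -/
def posIntegral {α : Type*} [MeasurableSpace α] (μ : Measure α) (f : α → EReal) : ENNReal :=
  ∫⁻ x, (f x).toENNReal ∂μ

/-- The integral of the negative part of an extended real valued function. -/
def negIntegral {α : Type*} [MeasurableSpace α] (μ : Measure α) (f : α → EReal) : ENNReal :=
  ∫⁻ x, (-f x).toENNReal ∂μ

/-- The integral `∫ f⁺ - ∫ f⁻` of `f` is meaningful in `[-∞, +∞]`: it is not `∞ - ∞`. -/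
def IntegralExists {α : Type*} [MeasurableSpace α] (μ : Measure α) (f : α → EReal) : Prop :=
  posIntegral μ f ≠ ⊤ ∨ negIntegral μ f ≠ ⊤

/-- The extended Lebesgue integral `∫ f⁺ - ∫ f⁻`, with the convention `∞ - ∞ = +∞`
(the integral exists, in the sense of `IntegralExists`, exactly when the convention is unused). -/
def extIntegral {α : Type*} [MeasurableSpace α] (μ : Measure α) (f : α → EReal) : EReal :=
  if posIntegral μ f = ⊤ then ⊤ else (posIntegral μ f : EReal) - (negIntegral μ f : EReal)

/-- `sup_{ξ ∈ V} {⟨ξ, x⟩ - Λ_{η^n}(ξ)}`, where `η` is the exponential measure. -/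
def expoSup {n : ℕ} (V : Set (Fin n → ℝ)) (x : Fin n → ℝ) : EReal :=
  ⨆ ξ ∈ V, (((ξ ⬝ᵥ x : ℝ) : EReal) - logLaplace (expoPi n) ξ)

/-- `sup_{ξ ∈ V} ⟨Λ_η(ξ), x - u⟩`, where `η` is the exponential measure, `u = (1, …, 1)` and
`Λ_η(ξ) = (Λ_η(ξ_1), …, Λ_η(ξ_n))`. -/
def expoWidthSup {n : ℕ} (V : Set (Fin n → ℝ)) (x : Fin n → ℝ) : EReal :=
  ⨆ ξ ∈ V, ∑ i, logLaplaceReal expo (ξ i) * ((x i - 1 : ℝ) : EReal)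

end

/-! A point ξ with infinite transform contributes -∞ on the left, and dropping it can only lower the
right, so all ξ_i < 1 may be assumed. Then ζ_i = Λ_η(ξ_i) = -log(1 - ξ_i) gives ξ_i = 1 - e^{-ζ_i}.

For a finite family the inequality is strengthened by an arbitrary constant c_k in each term
(`LogExpSupLE`). This form tensorizes: with one variable frozen, its terms are offsets for the
other, and a Jensen–Tonelli argument (`lintegral_exp_integral_le`) joins the two applications. Hence
n = 1 suffices.

There (`logExpSupLE_expo`), let w be the left integrand times e^{-y} and g the right integrand.
Since log u ≤ u - 1, log w(y) + x + x log(y/x) ≤ g(x) for x, y > 0. Evaluating at x = S(y), where S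
is the monotone map pushing w/∫w to η, and integrating by parts gives log ∫ w ≤ ∫ g dη. Monotone
convergence on the left yields countable V. -/

/-! ### Transport inequality on the half-line. -/

open Filter Topology Set in
/-- If `S` transports a density on the half-line to the standard exponential density, then a
pointwise lower bound on `g ∘ S` integrates to a lower bound on the exponential mean of `g`. -/
theorem le_integral_mul_exp_neg_of_transport {S s g : ℝ → ℝ} {L c : ℝ}
    (hS : ∀ y, 0 ≤ y → HasDerivAt S (s y) y) (hs : ∀ y, 0 ≤ y → 0 < s y) (hS0 : S 0 = 0)
    (hc : 0 < c) (hSc : ∀ᶠ b in atTop, c * b ≤ S b)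
    (hgi : IntegrableOn (fun x => g x * Real.exp (-x)) (Ioi 0))
    (h : ∀ y, 0 < y → L + Real.log (s y) + S y * Real.log (y / S y) ≤ g (S y)) :
    L ≤ ∫ x in Ioi 0, g x * Real.exp (-x) := by
  have hcont : ContinuousOn S (Ici 0) := fun y hy => (hS y hy).continuousAt.continuousWithinAt
  have hmono : StrictMonoOn S (Ici 0) := by
    refine strictMonoOn_of_deriv_pos (convex_Ici 0) hcont fun y hy => ?_
    rw [interior_Ici] at hy
    rw [(hS y (le_of_lt hy)).deriv]
    exact hs y (le_of_lt hy)
  have hpos : ∀ y, 0 < y → 0 < S y := fun y hy => by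
    rw [← hS0]; exact hmono self_mem_Ici hy.le hy
  have htop : Tendsto S atTop atTop :=
    tendsto_atTop_mono' _ hSc (tendsto_id.const_mul_atTop hc)
  have himg : S '' Ioi 0 = Ioi 0 := by
    refine Subset.antisymm (image_subset_iff.2 hpos) fun x hx => ?_
    obtain ⟨b, hb, hb0⟩ := ((htop.eventually_ge_atTop x).and (eventually_ge_atTop 0)).exists
    obtain ⟨y, hy, rfl⟩ := intermediate_value_Icc hb0 (hcont.mono Icc_subset_Ici_self)
      (show x ∈ Icc (S 0) (S b) from ⟨hS0.trans_le (le_of_lt hx), hb⟩)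
    refine ⟨y, lt_of_le_of_ne hy.1 ?_, rfl⟩
    rintro rfl
    exact absurd hx (by simp [hS0])
  have hinj : InjOn S (Ioi 0) := hmono.injOn.mono Ioi_subset_Ici_self
  have hder : ∀ x ∈ Ioi (0 : ℝ), HasDerivWithinAt S (s x) (Ioi 0) x :=
    fun x hx => (hS x (le_of_lt hx)).hasDerivWithinAt
  set φ : ℝ → ℝ := fun y => (g (S y) - L) * (s y * Real.exp (-S y)) with hφ
  have hLi : IntegrableOn (fun x => (g x - L) * Real.exp (-x)) (Ioi 0) := by
    simp_rw [sub_mul]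
    exact hgi.sub ((integrableOn_exp_neg_Ioi 0).const_mul L)
  have hφeq : EqOn (fun x => |s x| • ((fun x => (g x - L) * Real.exp (-x)) (S x))) φ (Ioi 0) := by
    intro x hx
    simp only [hφ, abs_of_pos (hs x (le_of_lt hx)), smul_eq_mul]
    ring
  have hφi : IntegrableOn φ (Ioi 0) := by
    rw [← himg, integrableOn_image_iff_integrableOn_abs_deriv_smul measurableSet_Ioi hder hinj]
      at hLi
    exact hLi.congr_fun hφeq measurableSet_Ioi
  have hφint : ∫ x in Ioi 0, φ x = (∫ x in Ioi 0, g x * Real.exp (-x)) - L := by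
    rw [← setIntegral_congr_fun measurableSet_Ioi hφeq,
      ← integral_image_eq_integral_abs_deriv_smul measurableSet_Ioi hder hinj
        (fun x => (g x - L) * Real.exp (-x)), himg]
    simp_rw [sub_mul]
    rw [integral_sub hgi ((integrableOn_exp_neg_Ioi 0).const_mul L), integral_const_mul,
      integral_exp_neg_Ioi]
    simp
  -- It remains to show ∫ φ ≥ 0. This G vanishes at 0, satisfies G' ≤ φ, and has a lower bound
  -- tending to 0 at infinity.
  set G : ℝ → ℝ := fun y => -(S y * Real.exp (-S y)) * Real.log (y / S y) with hG
  have hG0 : G 0 = 0 := by simp [hG, hS0]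
  have hGderiv : ∀ y, 0 < y → HasDerivAt G ((S y - 1) * (s y * Real.exp (-S y)) *
      Real.log (y / S y) - S y * Real.exp (-S y) * (1 / y - s y / S y)) y := by
    intro y hy
    have h1 := hS y hy.le
    have hSy := (hpos y hy).ne'
    have := (h1.mul h1.neg.exp).neg.mul (((hasDerivAt_id y).div h1 hSy).log
      (div_ne_zero hy.ne' hSy))
    refine this.congr_deriv ?_
    simp only [id, Pi.neg_apply, Pi.mul_apply, Pi.div_apply]
    field_simp
    ring
  have hG0cont : ContinuousWithinAt G (Ici 0) 0 := by
    rw [← continuousWithinAt_Ioi_iff_Ici, ContinuousWithinAt, hG0]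
    have hS' : Tendsto S (𝓝[>] 0) (𝓝 0) := by
      have := (hS 0 le_rfl).continuousAt.tendsto
      rw [hS0] at this
      exact this.mono_left nhdsWithin_le_nhds
    have hsl : Tendsto (fun y => y / S y) (𝓝[>] 0) (𝓝 (s 0)⁻¹) := by
      have h1 := (hasDerivAt_iff_tendsto_slope.1 (hS 0 le_rfl)).mono_left
        (nhdsWithin_mono 0 (fun y (hy : (0 : ℝ) < y) => hy.ne'))
      refine (h1.inv₀ (hs 0 le_rfl).ne').congr fun y => ?_
      simp [slope_def_field, hS0]
    have h2 := ((hS'.mul hS'.neg.rexp).neg).mul (hsl.log (inv_ne_zero (hs 0 le_rfl).ne'))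
    simpa [hG] using h2
  have hGcont : ContinuousOn G (Ici 0) := by
    intro y hy
    rcases eq_or_lt_of_le (show (0 : ℝ) ≤ y from hy) with rfl | hy
    · exact hG0cont
    · exact (hGderiv y hy).continuousAt.continuousWithinAt
  have hle : ∀ b, 0 ≤ b → G b ≤ ∫ y in (0 : ℝ)..b, φ y := by
    intro b hb
    have := intervalIntegral.sub_le_integral_of_hasDeriv_right_of_le hb
      (hGcont.mono Icc_subset_Ici_self) (fun x hx => (hGderiv x hx.1).hasDerivWithinAt)
      ((integrableOn_Ici_iff_integrableOn_Ioi (by simp)).2 hφi |>.mono_set Icc_subset_Ici_self) (φ := φ) ?_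
    · simpa [hG0] using this
    intro y hy
    have hSy := hpos y hy.1
    have hsy := hs y hy.1.le
    have hy0 := hy.1
    have h1 := h y hy.1
    -- With t = S/(s y), the difference between the lower bound for φ and G' is (t - 1 - log t) s
    -- e^{-S} ≥ 0.
    have ht : 0 < S y / (s y * y) := by positivity
    have h2 := Real.log_le_sub_one_of_pos ht
    have h3 : Real.log (S y / (s y * y)) = -(Real.log (s y) + Real.log (y / S y)) := by
      rw [Real.log_div hSy.ne' (mul_pos hsy hy0).ne', Real.log_mul hsy.ne' hy0.ne',
        Real.log_div hy0.ne' hSy.ne']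
      ring
    rw [h3] at h2
    have h4 : (S y - 1) * (s y * Real.exp (-S y)) *
      Real.log (y / S y) - S y * Real.exp (-S y) * (1 / y - s y / S y) =
      ((S y - 1) * Real.log (y / S y) - S y / (s y * y) + 1) * (s y * Real.exp (-S y)) := by
      field_simp
      ring
    rw [h4, hφ]
    refine mul_le_mul_of_nonneg_right ?_ (by positivity)
    linarith
  have hlim := intervalIntegral_tendsto_integral_Ioi 0 hφi tendsto_id
  rw [hφint] at hlim
  have hlim2 : Tendsto (fun b => -(S b * Real.exp (-S b)) * Real.log c⁻¹) atTop (𝓝 0) := by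
    have := ((Real.tendsto_pow_mul_exp_neg_atTop_nhds_zero 1).comp htop).neg.mul_const
      (Real.log c⁻¹)
    simpa using this
  have := le_of_tendsto_of_tendsto hlim2 hlim (by
    filter_upwards [hSc, eventually_gt_atTop 0] with b hb hb0
    refine le_trans ?_ (hle b hb0.le)
    have hSb := hpos b hb0
    -- The prefactor is nonpositive, so the linear growth of S, which gives y / S ≤ 1/c, bounds G
    -- from below.
    refine mul_le_mul_of_nonpos_left ?_ (neg_nonpos.2 (by positivity))
    refine Real.log_le_log (by positivity) ?_
    rw [div_le_iff₀ hSb, inv_mul_eq_div, le_div_iff₀ hc]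
    linarith)
  linarith

open Filter Topology Set in
/-- A one-dimensional Laplace-type inequality on the half-line: if
`log (w y) + x + x log (y / x) ≤ g x` for all `x, y > 0`, then
`log ∫ w ≤ ∫ g x e^{-x} dx`. -/
theorem log_integral_le_integral_mul_exp_neg {w g : ℝ → ℝ} {C c : ℝ} (hw : Continuous w)
    (hw0 : ∀ y, 0 < w y) (hc : 0 < c) (hwC : ∀ y, 0 ≤ y → w y ≤ C * Real.exp (-c * y))
    (hgi : IntegrableOn (fun x => g x * Real.exp (-x)) (Ioi 0))
    (h : ∀ x y, 0 < x → 0 < y → Real.log (w y) + x + x * Real.log (y / x) ≤ g x) :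
    Real.log (∫ y in Ioi 0, w y) ≤ ∫ x in Ioi 0, g x * Real.exp (-x) := by
  have hC : 0 < C := by simpa using (hw0 0).trans_le (hwC 0 le_rfl)
  have hei : ∀ a, IntegrableOn (fun y => C * Real.exp (-c * y)) (Ioi a) := fun a =>
    (integrableOn_exp_mul_Ioi (neg_lt_zero.2 hc) a).const_mul C
  have hwi₀ : IntegrableOn w (Ioi 0) := by
    refine (hei 0).mono' hw.aestronglyMeasurable ?_
    filter_upwards [ae_restrict_mem measurableSet_Ioi] with y hy
    rw [Real.norm_of_nonneg (hw0 y).le]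
    exact hwC y (le_of_lt hy)
  have hwi : ∀ a, IntegrableOn w (Ioi a) := fun a => by
    refine ((hw.integrableOn_Icc (a := a) (b := 0)).union hwi₀).mono_set fun y hy => ?_
    exact (le_or_gt y 0).imp (fun h => ⟨le_of_lt hy, h⟩) id
  have hWpos : ∀ y, 0 < ∫ t in Ioi y, w t := fun y => by
    rw [setIntegral_pos_iff_support_of_nonneg_ae (ae_of_all _ fun t => (hw0 t).le) (hwi y)]
    have : Function.support w = univ := Function.support_eq_univ fun t => (hw0 t).ne'
    simp [this]
  have hWle : ∀ y, 0 ≤ y → ∫ t in Ioi y, w t ≤ C / c * Real.exp (-c * y) := fun y hy => by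
    refine (setIntegral_mono_on (hwi y) (hei y) measurableSet_Ioi
      fun t ht => hwC t (hy.trans (le_of_lt ht))).trans_eq ?_
    rw [integral_const_mul, integral_exp_mul_Ioi (neg_lt_zero.2 hc)]
    field_simp
  have hWeq : ∀ y, ∫ t in Ioi y, w t = (∫ t in Ioi 0, w t) - ∫ t in (0 : ℝ)..y, w t := fun y => by
    rw [← intervalIntegral.integral_Ioi_sub_Ioi' (hwi 0) (hwi y)]
    ring
  have hWder : ∀ y, HasDerivAt (fun y => ∫ t in Ioi y, w t) (-w y) y := fun y => by
    have := (intervalIntegral.integral_hasDerivAt_right (hw.intervalIntegrable 0 y)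
      (hw.stronglyMeasurableAtFilter _ _) hw.continuousAt).const_sub (∫ t in Ioi 0, w t)
    exact this.congr_of_eventuallyEq (.of_forall hWeq)
  -- With W(y) the tail integral of w, S = log(W(0)/W(y)) matches tails: e^{-S} = W(y)/W(0). Its
  -- derivative is the hazard rate w/W. Halving c absorbs the additive constant in the growth bound.
  refine le_integral_mul_exp_neg_of_transport (c := c / 2)
    (S := fun y => Real.log (∫ t in Ioi 0, w t) - Real.log (∫ t in Ioi y, w t))
    (s := fun y => w y / ∫ t in Ioi y, w t) (fun y _ => ?_)
    (fun y _ => div_pos (hw0 y) (hWpos y)) (sub_self _) (half_pos hc) ?_ hgi fun y hy => ?_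
  · refine (((hWder y).log (hWpos y).ne').const_sub _).congr_deriv ?_
    ring
  · filter_upwards [eventually_ge_atTop
      ((Real.log (C / c) - Real.log (∫ t in Ioi 0, w t)) / (c / 2)), eventually_ge_atTop 0] with b hb hb0
    rw [div_le_iff₀ (half_pos hc)] at hb
    have h1 := Real.log_le_log (hWpos b) (hWle b hb0)
    rw [Real.log_mul (div_pos hC hc).ne' (Real.exp_pos _).ne', Real.log_exp] at h1
    linarith
  · have hS : 0 < Real.log (∫ t in Ioi 0, w t) - Real.log (∫ t in Ioi y, w t) := by
      refine sub_pos.2 (Real.log_lt_log (hWpos y) ?_)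
      rw [hWeq y]
      exact sub_lt_self _ (intervalIntegral.intervalIntegral_pos_of_pos
        (hw.intervalIntegrable 0 y) hw0 hy)
    have := h _ y hS hy
    rw [Real.log_div (hw0 y).ne' (hWpos y).ne']
    linarith

/-! ### The exponential measure and its Laplace transform. -/

open Set in
theorem expo_eq_withDensity :
    expo = (volume.restrict (Ioi 0)).withDensity fun x => ENNReal.ofReal (Real.exp (-x)) := by
  rw [restrict_Ioi_eq_restrict_Ici, ← withDensity_indicator measurableSet_Ici]
  rw [expo, ProbabilityTheory.expMeasure, ProbabilityTheory.gammaMeasure]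
  congr 1
  ext1 x
  change ProbabilityTheory.exponentialPDF 1 x = _
  rw [ProbabilityTheory.exponentialPDF_eq]
  by_cases hx : 0 ≤ x <;> simp [hx, indicator]

open Set in
theorem lintegral_expo (f : ℝ → ENNReal) (hf : Measurable f) :
    ∫⁻ x, f x ∂expo = ∫⁻ x in Ioi 0, f x * ENNReal.ofReal (Real.exp (-x)) := by
  rw [expo_eq_withDensity, lintegral_withDensity_eq_lintegral_mul _ (by fun_prop) hf]
  simp [mul_comm]

open Set in
theorem integral_expo (f : ℝ → ℝ) :
    ∫ x, f x ∂expo = ∫ x in Ioi 0, f x * Real.exp (-x) := by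
  rw [expo_eq_withDensity, integral_withDensity_eq_integral_toReal_smul (by fun_prop) (by simp)]
  refine integral_congr_ae (ae_of_all _ fun x => ?_)
  simp [ENNReal.toReal_ofReal (Real.exp_pos _).le, mul_comm]

open Set in
theorem integrable_expo_iff (f : ℝ → ℝ) :
    Integrable f expo ↔ IntegrableOn (fun x => f x * Real.exp (-x)) (Ioi 0) := by
  rw [expo_eq_withDensity, integrable_withDensity_iff_integrable_smul' (by fun_prop) (by simp)]
  simp [ENNReal.toReal_ofReal (Real.exp_pos _).le, mul_comm, IntegrableOn]

instance : IsProbabilityMeasure expo := by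
  unfold expo; exact ProbabilityTheory.isProbabilityMeasure_expMeasure one_pos

theorem integrable_id_expo : Integrable (fun x => x) expo := by
  rw [integrable_expo_iff]
  have := Real.GammaIntegral_convergent (s := 2) two_pos
  refine this.congr_fun (fun x _ => ?_) measurableSet_Ioi
  norm_num [mul_comm]

theorem lintegral_exp_mul_expo {t : ℝ} (ht : t < 1) :
    ∫⁻ x, ENNReal.ofReal (Real.exp (t * x)) ∂expo = ENNReal.ofReal (1 - t)⁻¹ := by
  rw [lintegral_expo _ (by fun_prop)]
  have h : ∀ x : ℝ, ENNReal.ofReal (Real.exp (t * x)) * ENNReal.ofReal (Real.exp (-x)) =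
      ENNReal.ofReal (Real.exp ((t - 1) * x)) := fun x => by
    rw [← ENNReal.ofReal_mul (Real.exp_pos _).le, ← Real.exp_add]
    ring_nf
  simp_rw [h]
  rw [← ofReal_integral_eq_lintegral_ofReal (integrableOn_exp_mul_Ioi (by linarith) 0)
    (ae_of_all _ fun x => (Real.exp_pos _).le), integral_exp_mul_Ioi (by linarith)]
  congr 1
  rw [mul_zero, Real.exp_zero, ← neg_sub 1 t, neg_div_neg_eq, one_div]

theorem lintegral_exp_mul_expo_eq_top {t : ℝ} (ht : 1 ≤ t) :
    ∫⁻ x, ENNReal.ofReal (Real.exp (t * x)) ∂expo = ⊤ := by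
  rw [lintegral_expo _ (by fun_prop), eq_top_iff]
  have h : ∀ x ∈ Set.Ioi (0 : ℝ), (1 : ENNReal) ≤
      ENNReal.ofReal (Real.exp (t * x)) * ENNReal.ofReal (Real.exp (-x)) := fun x hx => by
    rw [← ENNReal.ofReal_mul (Real.exp_pos _).le, ← Real.exp_add, ENNReal.one_le_ofReal,
      Real.one_le_exp_iff]
    nlinarith [Set.mem_Ioi.1 hx]
  refine le_trans ?_ (setLIntegral_mono' measurableSet_Ioi h)
  simp

/-! ### Suprema with offsets and tensorization. -/

theorem abs_ciSup_le_sum {ι : Type*} [Fintype ι] [Nonempty ι] (f : ι → ℝ) :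
    |⨆ k, f k| ≤ ∑ k, |f k| := by
  have h : ∀ k, |f k| ≤ ∑ k, |f k| := fun k =>
    Finset.single_le_sum (f := fun k => |f k|) (fun _ _ => abs_nonneg _) (Finset.mem_univ k)
  obtain ⟨k⟩ := ‹Nonempty ι›
  rw [abs_le]
  refine ⟨?_, ciSup_le fun k => (le_abs_self _).trans (h k)⟩
  exact (neg_le_neg (h k)).trans ((neg_abs_le _).trans
    (le_ciSup (Set.finite_range f).bddAbove k))

theorem integrable_ciSup {ι Ω : Type*} [Fintype ι] [Nonempty ι] [MeasurableSpace Ω] {μ : Measure Ω}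
    {f : ι → Ω → ℝ} (hm : ∀ k, Measurable (f k)) (hf : ∀ k, Integrable (f k) μ) :
    Integrable (fun x => ⨆ k, f k x) μ := by
  refine (integrable_finsetSum Finset.univ fun k _ => (hf k).abs).mono'
    (Measurable.iSup hm).aestronglyMeasurable (ae_of_all _ fun x => ?_)
  exact abs_ciSup_le_sum _

/-- For all offsets `c`, the log-exponential mean of `sup_k (A k + c k)` is at most the mean of
`sup_k (B k + c k)`. -/
structure LogExpSupLE {ι Ω : Type*} [MeasurableSpace Ω] (μ : Measure Ω) (A B : ι → Ω → ℝ) :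
    Prop where
  measurable_left : ∀ k, Measurable (A k)
  measurable_right : ∀ k, Measurable (B k)
  integrable_right : ∀ k, Integrable (B k) μ
  le : ∀ c : ι → ℝ, ∫⁻ x, ENNReal.ofReal (Real.exp (⨆ k, (A k x + c k))) ∂μ ≤
    ENNReal.ofReal (Real.exp (∫ x, ⨆ k, (B k x + c k) ∂μ))

/-- Jensen's inequality for the exponential function. -/
theorem ofReal_exp_integral_le {Ω : Type*} [MeasurableSpace Ω] {μ : Measure Ω}
    [IsProbabilityMeasure μ] {f : Ω → ℝ} (hf : Integrable f μ) :
    ENNReal.ofReal (Real.exp (∫ x, f x ∂μ)) ≤ ∫⁻ x, ENNReal.ofReal (Real.exp (f x)) ∂μ := by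
  by_cases h : ∫⁻ x, ENNReal.ofReal (Real.exp (f x)) ∂μ = ⊤
  · rw [h]; exact le_top
  have hi : Integrable (fun x => Real.exp (f x)) μ :=
    (lintegral_ofReal_ne_top_iff_integrable (Real.continuous_exp.comp_aestronglyMeasurable hf.1)
      (ae_of_all _ fun x => (Real.exp_pos _).le)).1 h
  rw [← ofReal_integral_eq_lintegral_ofReal hi (ae_of_all _ fun x => (Real.exp_pos _).le)]
  exact ENNReal.ofReal_le_ofReal (convexOn_exp.map_integral_le Real.continuous_exp.continuousOn
    isClosed_univ (by simp) hf hi)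

/-- Exponential means of integrals are controlled by integrals of log-exponential means. -/
theorem lintegral_exp_integral_le {Ω₁ Ω₂ : Type*} [MeasurableSpace Ω₁] [MeasurableSpace Ω₂]
    {μ : Measure Ω₁} {ν : Measure Ω₂} [IsProbabilityMeasure μ] [IsProbabilityMeasure ν]
    {G : Ω₁ → Ω₂ → ℝ} {l : Ω₁ → ℝ} (hGm : Measurable (Function.uncurry G)) (hl : Measurable l)
    (hG : ∀ y, Integrable (fun x => G x y) μ) (hli : Integrable l μ)
    (h : ∀ x, ∫⁻ y, ENNReal.ofReal (Real.exp (G x y)) ∂ν ≤ ENNReal.ofReal (Real.exp (l x))) :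
    ∫⁻ y, ENNReal.ofReal (Real.exp (∫ x, G x y ∂μ)) ∂ν ≤
      ENNReal.ofReal (Real.exp (∫ x, l x ∂μ)) := by
  -- Jensen is applied to G - l, so that after Tonelli each inner integral over y is at most 1.
  have h1 : ∀ y, ENNReal.ofReal (Real.exp (∫ x, G x y ∂μ)) ≤
      ENNReal.ofReal (Real.exp (∫ x, l x ∂μ)) *
        ∫⁻ x, ENNReal.ofReal (Real.exp (G x y - l x)) ∂μ := fun y => by
    have := ofReal_exp_integral_le ((hG y).sub hli)
    simp only [Pi.sub_apply] at this
    refine le_trans (le_of_eq ?_) (mul_le_mul_right this _)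
    rw [integral_sub (hG y) hli, ← ENNReal.ofReal_mul (Real.exp_pos _).le, ← Real.exp_add]
    ring_nf
  have hm : Measurable (Function.uncurry fun y x => ENNReal.ofReal (Real.exp (G x y - l x))) := by
    have := hGm.comp measurable_swap
    exact ENNReal.measurable_ofReal.comp (Real.measurable_exp.comp
      (this.sub (hl.comp measurable_snd)))
  have hm' : Measurable fun y => ∫⁻ x, ENNReal.ofReal (Real.exp (G x y - l x)) ∂μ :=
    hm.lintegral_prod_right'
  refine (lintegral_mono h1).trans ?_
  rw [lintegral_const_mul _ hm', lintegral_lintegral_swap hm.aemeasurable]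
  have h2 : ∀ x, ∫⁻ y, ENNReal.ofReal (Real.exp (G x y - l x)) ∂ν ≤ 1 := fun x => by
    have : ∀ y, ENNReal.ofReal (Real.exp (G x y - l x)) =
        ENNReal.ofReal (Real.exp (-l x)) * ENNReal.ofReal (Real.exp (G x y)) := fun y => by
      rw [← ENNReal.ofReal_mul (Real.exp_pos _).le, ← Real.exp_add]
      ring_nf
    simp_rw [this]
    rw [lintegral_const_mul' _ _ ENNReal.ofReal_ne_top]
    refine (mul_le_mul_right (h x) _).trans_eq ?_
    rw [← ENNReal.ofReal_mul (Real.exp_pos _).le, ← Real.exp_add]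
    simp
  calc _ ≤ ENNReal.ofReal (Real.exp (∫ x, l x ∂μ)) * ∫⁻ _, 1 ∂μ := by
        gcongr with x; exact h2 x
    _ = _ := by simp

theorem LogExpSupLE.prod {ι Ω₁ Ω₂ : Type*} [Fintype ι] [Nonempty ι] [MeasurableSpace Ω₁]
    [MeasurableSpace Ω₂] {μ : Measure Ω₁} {ν : Measure Ω₂} [IsProbabilityMeasure μ]
    [IsProbabilityMeasure ν] {A₁ B₁ : ι → Ω₁ → ℝ} {A₂ B₂ : ι → Ω₂ → ℝ}
    (h₁ : LogExpSupLE μ A₁ B₁) (h₂ : LogExpSupLE ν A₂ B₂) :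
    LogExpSupLE (μ.prod ν) (fun k z => A₁ k z.1 + A₂ k z.2) (fun k z => B₁ k z.1 + B₂ k z.2) := by
  have hA₁ := h₁.measurable_left
  have hB₁ := h₁.measurable_right
  have hA₂ := h₂.measurable_left
  have hB₂ := h₂.measurable_right
  refine ⟨fun k => by fun_prop, fun k => by fun_prop,
    fun k => (h₁.integrable_right k).comp_fst ν |>.add ((h₂.integrable_right k).comp_snd μ),
    fun c => ?_⟩
  have hBm : Measurable fun z : Ω₁ × Ω₂ => ⨆ k, (B₁ k z.1 + B₂ k z.2 + c k) :=
    Measurable.iSup fun k => by fun_prop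
  have hBi : Integrable (fun z : Ω₁ × Ω₂ => ⨆ k, (B₁ k z.1 + B₂ k z.2 + c k)) (μ.prod ν) :=
    integrable_ciSup (fun k => by fun_prop) fun k =>
      ((h₁.integrable_right k).comp_fst ν |>.add ((h₂.integrable_right k).comp_snd μ)).add
        (integrable_const _)
  have hAm : Measurable fun z : Ω₁ × Ω₂ => ⨆ k, (A₁ k z.1 + A₂ k z.2 + c k) :=
    Measurable.iSup fun k => by fun_prop
  have hGm : Measurable fun z : Ω₁ × Ω₂ => ⨆ k, (B₁ k z.1 + A₂ k z.2 + c k) :=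
    Measurable.iSup fun k => by fun_prop
  rw [lintegral_prod_symm _ (by fun_prop), integral_prod _ hBi]
  refine le_trans (lintegral_mono fun y => ?_) (lintegral_exp_integral_le
    (G := fun x y => ⨆ k, (B₁ k x + A₂ k y + c k))
    (l := fun x => ∫ y, ⨆ k, (B₁ k x + B₂ k y + c k) ∂ν) hGm ?_ (fun y => ?_)
    hBi.integral_prod_left fun x => ?_)
  -- For fixed y the second factor enters as an offset; this is why the inequality is required for
  -- all c.
  · simpa only [add_assoc] using h₁.le fun k => A₂ k y + c k
  · exact hBm.stronglyMeasurable.integral_prod_right'.measurable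
  · exact integrable_ciSup (fun k => by fun_prop) fun k =>
      ((h₁.integrable_right k).add (integrable_const _)).add (integrable_const _)
  · simpa only [add_assoc, add_left_comm] using h₂.le fun k => B₁ k x + c k

/-! ### The finite inequality for η and its powers. -/

theorem exists_ciSup_exp_bound {ι : Type*} [Fintype ι] [Nonempty ι] (r b : ι → ℝ)
    (hr : ∀ k, 0 < r k) : ∃ C c : ℝ, 0 < c ∧
      ∀ y, 0 ≤ y → Real.exp (⨆ k, (b k - r k * y)) ≤ C * Real.exp (-c * y) := by
  obtain ⟨k₀, hk₀⟩ := Finite.exists_min r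
  refine ⟨Real.exp (⨆ k, b k), r k₀, hr k₀, fun y hy => ?_⟩
  rw [← Real.exp_add, Real.exp_le_exp]
  refine ciSup_le fun k => ?_
  have h1 := le_ciSup (Set.finite_range b).bddAbove k
  have h2 := mul_le_mul_of_nonneg_right (hk₀ k) hy
  linarith

theorem logExpSupLE_expo {ι : Type*} [Fintype ι] [Nonempty ι] (ζ : ι → ℝ) :
    LogExpSupLE expo (fun k x => (1 - Real.exp (-ζ k)) * x - ζ k) (fun k x => ζ k * (x - 1)) := by
  have hBi : ∀ k, Integrable (fun x => ζ k * (x - 1)) expo := fun k =>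
    (integrable_id_expo.sub (integrable_const 1)).const_mul (ζ k)
  refine ⟨fun k => by fun_prop, fun k => by fun_prop, hBi, fun c => ?_⟩
  have hgi : Integrable (fun x => ⨆ k, (ζ k * (x - 1) + c k)) expo :=
    integrable_ciSup (fun k => by fun_prop) fun k => (hBi k).add (integrable_const _)
  rw [integrable_expo_iff] at hgi
  set w : ℝ → ℝ := fun y => Real.exp (⨆ k, (c k - ζ k - Real.exp (-ζ k) * y)) with hw
  have hw0 : ∀ y, 0 < w y := fun y => Real.exp_pos _
  have hwc : Continuous w := by
    refine Real.continuous_exp.comp ?_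
    simp_rw [← Finset.sup'_univ_eq_ciSup]
    exact Continuous.finset_sup'_apply _ fun k _ => by fun_prop
  obtain ⟨C, r, hr, hC⟩ := exists_ciSup_exp_bound (fun k => Real.exp (-ζ k)) (fun k => c k - ζ k)
    fun k => Real.exp_pos _
  have key := log_integral_le_integral_mul_exp_neg hwc hw0 hr hC hgi fun x y hx hy => by
    obtain ⟨k, hk⟩ := exists_eq_ciSup_of_finite (f := fun k => c k - ζ k - Real.exp (-ζ k) * y)
    have h1 := le_ciSup (Set.finite_range fun k => ζ k * (x - 1) + c k).bddAbove k
    rw [hw, Real.log_exp, ← hk]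
    -- For the index k attaining the supremum in w(y), the required bound is x times log u ≤ u - 1
    -- at u = e^{-ζ_k} y / x.
    have h2 := Real.log_le_sub_one_of_pos (show 0 < Real.exp (-ζ k) * (y / x) by positivity)
    rw [Real.log_mul (Real.exp_pos _).ne' (div_pos hy hx).ne', Real.log_exp] at h2
    have h3 := mul_le_mul_of_nonneg_left h2 hx.le
    have h4 : x * (Real.exp (-ζ k) * (y / x) - 1) = Real.exp (-ζ k) * y - x := by
      field_simp
    linarith
  have hwi : IntegrableOn w (Set.Ioi 0) := by
    refine ((integrableOn_exp_mul_Ioi (neg_lt_zero.2 hr) 0).const_mul C).mono'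
      hwc.aestronglyMeasurable ?_
    filter_upwards [ae_restrict_mem measurableSet_Ioi] with y hy
    rw [Real.norm_of_nonneg (hw0 y).le]
    exact hC y (le_of_lt hy)
  have hWpos : 0 < ∫ t in Set.Ioi 0, w t := by
    rw [setIntegral_pos_iff_support_of_nonneg_ae (ae_of_all _ fun t => (hw0 t).le) hwi]
    have : Function.support w = Set.univ := Function.support_eq_univ fun t => (hw0 t).ne'
    simp [this]
  rw [lintegral_expo _ (by
    exact ENNReal.measurable_ofReal.comp (Real.measurable_exp.comp
      (Measurable.iSup fun k => by fun_prop))), integral_expo]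
  have hwe : ∀ x, ENNReal.ofReal (Real.exp (⨆ k, ((1 - Real.exp (-ζ k)) * x - ζ k + c k))) *
      ENNReal.ofReal (Real.exp (-x)) = ENNReal.ofReal (w x) := fun x => by
    rw [← ENNReal.ofReal_mul (Real.exp_pos _).le, ← Real.exp_add,
      ciSup_add (Set.finite_range _).bddAbove]
    simp only [hw]
    congr! 4
    ring
  simp_rw [hwe]
  rw [← ofReal_integral_eq_lintegral_ofReal hwi (ae_of_all _ fun t => (hw0 t).le)]
  exact ENNReal.ofReal_le_ofReal ((Real.log_le_iff_le_exp hWpos).1 key)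

theorem LogExpSupLE.comp_measurePreserving {ι Ω₁ Ω₂ : Type*} [Fintype ι] [Nonempty ι]
    [MeasurableSpace Ω₁] [MeasurableSpace Ω₂] {μ : Measure Ω₁} {ν : Measure Ω₂}
    {A B : ι → Ω₂ → ℝ} (h : LogExpSupLE ν A B) (e : Ω₁ ≃ᵐ Ω₂) (he : MeasurePreserving e μ ν) :
    LogExpSupLE μ (fun k x => A k (e x)) (fun k x => B k (e x)) := by
  refine ⟨fun k => (h.measurable_left k).comp e.measurable,
    fun k => (h.measurable_right k).comp e.measurable,
    fun k => he.integrable_comp_of_integrable (h.integrable_right k), fun c => ?_⟩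
  have h1 := he.lintegral_comp_emb e.measurableEmbedding
    fun x => ENNReal.ofReal (Real.exp (⨆ k, (A k x + c k)))
  have h2 := he.integral_comp e.measurableEmbedding fun x => ⨆ k, (B k x + c k)
  rw [h1, h2]
  exact h.le c

instance (n : ℕ) : IsProbabilityMeasure (expoPi n) := by unfold expoPi; infer_instance

theorem logExpSupLE_expoPi {ι : Type*} [Fintype ι] [Nonempty ι] (n : ℕ) (ζ : ι → Fin n → ℝ) :
    LogExpSupLE (expoPi n) (fun k x => ∑ i, ((1 - Real.exp (-ζ k i)) * x i - ζ k i))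
      (fun k x => ∑ i, ζ k i * (x i - 1)) := by
  induction n with
  | zero =>
    refine ⟨fun k => by fun_prop, fun k => by fun_prop, fun k => by simp, fun c => by simp⟩
  | succ n ih =>
    have h := ((logExpSupLE_expo fun k => ζ k 0).prod
      (ih fun k i => ζ k i.succ)).comp_measurePreserving
      (MeasurableEquiv.piFinSuccAbove (fun _ => ℝ) 0)
      (measurePreserving_piFinSuccAbove (fun _ => expo) 0)
    simp only [Fin.sum_univ_succ]
    exact h

/-! ### Logarithmic Laplace transform of the product. -/

theorem lintegral_exp_dotProduct_expoPi (n : ℕ) (ξ : Fin n → ℝ) :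
    ∫⁻ x, ENNReal.ofReal (Real.exp (ξ ⬝ᵥ x)) ∂(expoPi n) =
      ∏ i, ∫⁻ x, ENNReal.ofReal (Real.exp (ξ i * x)) ∂expo := by
  induction n with
  | zero => simp
  | succ n ih =>
    have h := (measurePreserving_piFinSuccAbove (fun _ : Fin (n + 1) => expo) 0).lintegral_comp_emb
      (MeasurableEquiv.measurableEmbedding _)
      fun z => ENNReal.ofReal (Real.exp (ξ 0 * z.1)) *
        ENNReal.ofReal (Real.exp ((fun i => ξ i.succ) ⬝ᵥ z.2))
    rw [lintegral_prod_mul (f := fun x => ENNReal.ofReal (Real.exp (ξ 0 * x)))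
      (g := fun y : Fin n → ℝ => ENNReal.ofReal (Real.exp ((fun i => ξ i.succ) ⬝ᵥ y)))
      (by fun_prop) (by
        have : Measurable fun y : Fin n → ℝ => (fun i => ξ i.succ) ⬝ᵥ y :=
          Finset.measurable_fun_sum _ fun i _ => (measurable_pi_apply i).const_mul _
        fun_prop)] at h
    rw [Fin.prod_univ_succ, ← ih]
    refine Eq.trans (lintegral_congr fun x => ?_) h
    rw [← ENNReal.ofReal_mul (Real.exp_pos _).le, ← Real.exp_add, dotProduct, Fin.sum_univ_succ]
    rfl

theorem logLaplaceReal_expo {t : ℝ} (ht : t < 1) :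
    logLaplaceReal expo t = ((-Real.log (1 - t) : ℝ) : EReal) := by
  rw [logLaplaceReal, lintegral_exp_mul_expo ht,
    ENNReal.log_ofReal_of_pos (inv_pos.2 (sub_pos.2 ht)), Real.log_inv]

theorem logLaplace_expoPi {n : ℕ} {ξ : Fin n → ℝ} (hξ : ∀ i, ξ i < 1) :
    logLaplace (expoPi n) ξ = ((∑ i, -Real.log (1 - ξ i) : ℝ) : EReal) := by
  have hp : ∀ i, 0 < (1 - ξ i)⁻¹ := fun i => inv_pos.2 (sub_pos.2 (hξ i))
  rw [logLaplace, lintegral_exp_dotProduct_expoPi]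
  simp_rw [fun i => lintegral_exp_mul_expo (hξ i)]
  rw [← ENNReal.ofReal_prod_of_nonneg fun i _ => (hp i).le,
    ENNReal.log_ofReal_of_pos (Finset.prod_pos fun i _ => hp i),
    Real.log_prod fun i _ => (hp i).ne']
  simp_rw [Real.log_inv]

theorem lt_one_of_logLaplace_expoPi_ne_top {n : ℕ} {ξ : Fin n → ℝ}
    (h : logLaplace (expoPi n) ξ ≠ ⊤) (i : Fin n) : ξ i < 1 := by
  contrapose! h
  rw [logLaplace, ENNReal.log_eq_top_iff, lintegral_exp_dotProduct_expoPi,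
    ← Finset.mul_prod_erase _ _ (Finset.mem_univ i), lintegral_exp_mul_expo_eq_top h,
    ENNReal.top_mul]
  -- The other factors must be nonzero, since 0 * ⊤ = 0.
  refine Finset.prod_ne_zero_iff.2 fun j _ => ?_
  rcases lt_or_ge (ξ j) 1 with hj | hj
  · rw [lintegral_exp_mul_expo hj]
    simpa using hj
  · simp [lintegral_exp_mul_expo_eq_top hj]

/-! ### Extended-real integrals and finite V. -/

theorem EReal.coe_ciSup_of_finite {ι : Type*} [Finite ι] [Nonempty ι] (f : ι → ℝ) :
    ((⨆ k, f k : ℝ) : EReal) = ⨆ k, (f k : EReal) := by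
  refine le_antisymm ?_ (iSup_le fun k =>
    EReal.coe_le_coe (le_ciSup (Set.finite_range f).bddAbove k))
  obtain ⟨k, hk⟩ := exists_eq_ciSup_of_finite (f := f)
  rw [← hk]
  exact le_iSup (fun k => (f k : EReal)) k

theorem EReal.coe_real_finset_sum {ι : Type*} (s : Finset ι) (f : ι → ℝ) :
    ((∑ i ∈ s, f i : ℝ) : EReal) = ∑ i ∈ s, (f i : EReal) := by
  classical
  induction s using Finset.induction_on with
  | empty => simp
  | insert a s ha ih => simp [Finset.sum_insert ha, ih]

theorem expoSup_range {ι : Type*} [Finite ι] [Nonempty ι] {n : ℕ} {ξ : ι → Fin n → ℝ}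
    (hξ : ∀ k i, ξ k i < 1) (x : Fin n → ℝ) :
    expoSup (Set.range ξ) x =
      ((⨆ k, ∑ i, (ξ k i * x i - -Real.log (1 - ξ k i)) : ℝ) : EReal) := by
  rw [expoSup, iSup_range, EReal.coe_ciSup_of_finite]
  refine iSup_congr fun k => ?_
  rw [logLaplace_expoPi (hξ k), ← EReal.coe_sub, dotProduct, Finset.sum_sub_distrib]

theorem expoWidthSup_range {ι : Type*} [Finite ι] [Nonempty ι] {n : ℕ} {ξ : ι → Fin n → ℝ}
    (hξ : ∀ k i, ξ k i < 1) (x : Fin n → ℝ) :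
    expoWidthSup (Set.range ξ) x =
      ((⨆ k, ∑ i, -Real.log (1 - ξ k i) * (x i - 1) : ℝ) : EReal) := by
  rw [expoWidthSup, iSup_range, EReal.coe_ciSup_of_finite]
  refine iSup_congr fun k => ?_
  rw [EReal.coe_real_finset_sum]
  refine Finset.sum_congr rfl fun i _ => ?_
  rw [logLaplaceReal_expo (hξ k i), EReal.coe_mul]

theorem extIntegral_mono {α : Type*} [MeasurableSpace α] (μ : Measure α) {f g : α → EReal}
    (h : f ≤ g) : extIntegral μ f ≤ extIntegral μ g := by
  have hp : posIntegral μ f ≤ posIntegral μ g :=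
    lintegral_mono fun x => EReal.toENNReal_le_toENNReal (h x)
  have hn : negIntegral μ g ≤ negIntegral μ f :=
    lintegral_mono fun x => EReal.toENNReal_le_toENNReal (EReal.neg_le_neg_iff.2 (h x))
  unfold extIntegral
  by_cases hg : posIntegral μ g = ⊤
  · simp [hg]
  · rw [if_neg hg, if_neg (ne_top_of_le_ne_top hg hp)]
    exact EReal.sub_le_sub (EReal.coe_ennreal_le_coe_ennreal_iff.2 hp)
      (EReal.coe_ennreal_le_coe_ennreal_iff.2 hn)

theorem posIntegral_coe_ne_top {α : Type*} [MeasurableSpace α] {μ : Measure α} {f : α → ℝ}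
    (hf : Integrable f μ) : posIntegral μ (fun x => (f x : EReal)) ≠ ⊤ :=
  ((lintegral_mono fun x => Real.ofReal_le_enorm (f x)).trans_lt hf.2).ne

theorem negIntegral_coe_ne_top {α : Type*} [MeasurableSpace α] {μ : Measure α} {f : α → ℝ}
    (hf : Integrable f μ) : negIntegral μ (fun x => (f x : EReal)) ≠ ⊤ := by
  have := posIntegral_coe_ne_top hf.neg
  simpa [posIntegral, negIntegral] using this

theorem extIntegral_coe {α : Type*} [MeasurableSpace α] {μ : Measure α} {f : α → ℝ}
    (hf : Integrable f μ) : extIntegral μ (fun x => (f x : EReal)) = ((∫ x, f x ∂μ : ℝ) : EReal) := by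
  have hp := posIntegral_coe_ne_top hf
  have hn := negIntegral_coe_ne_top hf
  rw [extIntegral, if_neg hp, integral_eq_lintegral_pos_part_sub_lintegral_neg_part hf,
    EReal.coe_sub]
  exact congrArg₂ _ (EReal.coe_ennreal_toReal hp).symm (EReal.coe_ennreal_toReal hn).symm

theorem log_lintegral_exp_expoSup_range_le {ι : Type*} [Fintype ι] [Nonempty ι] {n : ℕ}
    {ξ : ι → Fin n → ℝ} (hξ : ∀ k i, ξ k i < 1) :
    ENNReal.log (∫⁻ x, EReal.exp (expoSup (Set.range ξ) x) ∂(expoPi n)) ≤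
      extIntegral (expoPi n) (expoWidthSup (Set.range ξ)) := by
  have h := logExpSupLE_expoPi n fun k i => -Real.log (1 - ξ k i)
  have hi := integrable_ciSup h.measurable_right h.integrable_right
  have hle := h.le 0
  have he : ∀ k i, 1 - Real.exp (Real.log (1 - ξ k i)) = ξ k i := fun k i => by
    rw [Real.exp_log (sub_pos.2 (hξ k i))]; ring
  simp only [Pi.zero_apply, add_zero, neg_neg, he] at hle
  rw [funext (expoWidthSup_range hξ), extIntegral_coe hi]
  simp_rw [expoSup_range hξ, EReal.exp_coe]
  refine (ENNReal.log_le_log hle).trans_eq ?_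
  rw [ENNReal.log_ofReal_of_pos (Real.exp_pos _), Real.log_exp]

/-! ### Countable V and infinite transforms. -/

theorem expoWidthSup_mono {n : ℕ} {V W : Set (Fin n → ℝ)} (h : V ⊆ W) :
    expoWidthSup V ≤ expoWidthSup W := fun _ => biSup_mono h

theorem log_lintegral_exp_expoSup_le {n : ℕ} {V : Set (Fin n → ℝ)} (hV : V.Countable)
    (hV1 : ∀ ξ ∈ V, ∀ i, ξ i < 1) :
    ENNReal.log (∫⁻ x, EReal.exp (expoSup V x) ∂(expoPi n)) ≤
      extIntegral (expoPi n) (expoWidthSup V) := by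
  rcases V.eq_empty_or_nonempty with rfl | hne
  · simp [expoSup]
  obtain ⟨f, rfl⟩ := hV.exists_eq_range hne
  have hf : ∀ m i, f m i < 1 := fun m => hV1 _ ⟨m, rfl⟩
  -- Initial segments of the enumeration, nonempty so that their suprema are real. Only the left
  -- side needs a limit; the right side is bounded by monotonicity.
  set g : (m : ℕ) → Fin (m + 1) → Fin n → ℝ := fun m k => f k
  have hsub : ∀ m, Set.range (g m) ⊆ Set.range f := fun m => by
    rintro _ ⟨k, rfl⟩; exact ⟨k, rfl⟩
  have hmono : Monotone fun m => Set.range (g m) := by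
    rintro a b hab _ ⟨k, rfl⟩
    exact ⟨⟨k, by omega⟩, rfl⟩
  have hsup : ∀ x, expoSup (Set.range f) x = ⨆ m, expoSup (Set.range (g m)) x := fun x => by
    refine le_antisymm ?_ (iSup_le fun m => biSup_mono fun _ h => hsub m h)
    refine iSup₂_le ?_
    rintro _ ⟨m, rfl⟩
    refine le_iSup_of_le m (le_iSup₂_of_le (f m) ⟨Fin.last m, rfl⟩ le_rfl)
  have hexp : ∀ x, EReal.exp (expoSup (Set.range f) x) =
      ⨆ m, EReal.exp (expoSup (Set.range (g m)) x) := fun x => by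
    rw [hsup]
    exact EReal.expOrderIso.map_iSup _
  simp_rw [hexp]
  rw [lintegral_iSup]
  · refine (ENNReal.logOrderIso.map_iSup _).trans_le (iSup_le fun m => ?_)
    exact (log_lintegral_exp_expoSup_range_le (ξ := g m) fun k i => hf k i).trans
      (extIntegral_mono _ (expoWidthSup_mono (hsub m)))
  · intro m
    refine EReal.measurable_exp.comp ?_
    rw [funext (expoSup_range (ξ := g m) fun k i => hf k i)]
    exact measurable_coe_real_ereal.comp (Measurable.iSup fun k => by fun_prop)
  · intro a b hab x
    exact EReal.exp_monotone (biSup_mono fun _ h => hmono hab h)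

/-- Any single ξ in V gives an integrable minorant, so the negative part has finite integral; for
empty V the positive part vanishes. -/
theorem integralExists_expoWidthSup {n : ℕ} {V : Set (Fin n → ℝ)}
    (hV1 : ∀ ξ ∈ V, ∀ i, ξ i < 1) : IntegralExists (expoPi n) (expoWidthSup V) := by
  rcases V.eq_empty_or_nonempty with rfl | ⟨ξ, hξ⟩
  · left
    simp [posIntegral, expoWidthSup]
  right
  have h := logExpSupLE_expoPi n fun (_ : Unit) i => -Real.log (1 - ξ i)
  have hi := negIntegral_coe_ne_top (integrable_ciSup h.measurable_right h.integrable_right)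
  refine ne_top_of_le_ne_top hi (lintegral_mono fun x => EReal.toENNReal_le_toENNReal
    (EReal.neg_le_neg_iff.2 ?_))
  exact (expoWidthSup_range (ξ := fun _ : Unit => ξ) (fun _ => hV1 ξ hξ) x).symm.trans_le
    (expoWidthSup_mono (by simpa using hξ) x)

theorem expoSup_sep_ne_top {n : ℕ} (V : Set (Fin n → ℝ)) :
    expoSup {ξ ∈ V | logLaplace (expoPi n) ξ ≠ ⊤} = expoSup V := by
  ext1 x
  refine le_antisymm (biSup_mono fun _ h => h.1) (iSup₂_le fun ξ hξ => ?_)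
  by_cases h : logLaplace (expoPi n) ξ = ⊤
  · simp [h]
  · exact le_iSup₂_of_le ξ ⟨hξ, h⟩ le_rfl

theorem mainTheorem8 (n : ℕ) (V : Set (Fin n → ℝ)) (hV : V.Countable) :
    ENNReal.log (∫⁻ x, EReal.exp (expoSup V x) ∂(expoPi n)) ≤
        extIntegral (expoPi n) (expoWidthSup V) ∧
      ((∀ ξ ∈ V, logLaplace (expoPi n) ξ ≠ ⊤) →
        IntegralExists (expoPi n) (expoWidthSup V)) := by
  refine ⟨?_, fun h => integralExists_expoWidthSup fun ξ hξ =>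
    lt_one_of_logLaplace_expoPi_ne_top (h ξ hξ)⟩
  rw [← expoSup_sep_ne_top V]
  exact (log_lintegral_exp_expoSup_le (hV.mono (Set.sep_subset _ _)) fun ξ hξ =>
    lt_one_of_logLaplace_expoPi_ne_top hξ.2).trans
    (extIntegral_mono _ (expoWidthSup_mono (Set.sep_subset _ _)))
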